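/- **Conventions.** Let $\mathcal E$ be a complex Hilbert space and let $\mathbb T$ carry normalised Lebesgue measure. $L^2_{\mathcal E}(\mathbb T)$ is the space of (classes of) strongly measurable square-integrable $\mathcal E$-valued functions. $H^2_{\mathcal E}$ is the $\mathcal E$-valued Hardy space of the unit disc, identified through boundary values with the closed subspace of those $f\in L^2_{\mathcal E}(\mathbb T)$ whose Fourier coefficients of negative index vanish. For a closed subspace $\mathcal E_0\subseteq\mathcal E$, $H^2_{\mathcal E_0}\subseteq H^2_{\mathcal E}$ consists of the functions with values in $\mathcal E_0$ a.e. A symbol $\Phi\in L^\infty_{\mathcal B(\mathcal E)}(\mathbb T)$ is an essentially bounded function $\mathbb T\to\mathcal B(\mathcal E)$ which is measurable in the strong operator topology if $\mathcal E$ is separable, or strongly (Bochner) measurable for the operator norm, $\mathcal E$ being then arbitrary. $L_\Phi$ is multiplication by $\Phi$ on $L^2_{\mathcal E}(\mathbb T)$, and $T_\Phi=P_{H^2_{\mathcal E}}L_\Phi|_{H^2_{\mathcal E}}$. A closed subspace $\mathcal N$ reduces an operator $T$ if $T\mathcal N\subseteq\mathcal N$ and $T^*\mathcal N\subseteq\mathcal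 N$. The unitary part $\mathcal M_T$ of $T$ is the largest closed $T$-reducing subspace on which $T$ restricts to a unitary operator. For a unitary $W:\mathcal E_0\to\mathcal E_0$ on a closed subspace of $\mathcal E$, $T_W$ denotes the Toeplitz operator with constant symbol $W$, extended by $0$ on $\mathcal E_0^\perp$. **Theorem.** Let $T_\Phi$ be a Toeplitz operator on $H^2_{\mathcal E}$ with $\|T_\Phi\|\le 1$ and $\mathcal M_{T_\Phi}\neq\{0\}$. Then the following are equivalent: (i) $\mathcal M_{T_\Phi}=H^2_{\mathcal E_0}$ for some closed subspace $\mathcal E_0\subseteq\mathcal E$; (ii) there exist a closed subspace $\mathcal E_0\subseteq\mathcal E$ with $\mathcal M_{T_\Phi}\subseteq H^2_{\mathcal E_0}$ and a unitary $W:\mathcal E_0\to\mathcal E_0$ such that $T_\Phi|_{\mathcal M_{T_\Phi}}=T_W|_{H^2_{\mathcal E_0}}$, as an equality of maps including their domains; (ii$'$) there exist a closed subspace $\mathcal E_0\subseteq\mathcal E$ with $\mathcal M_{T_\Phi}\subseteq H^2_{\mathcal E_0}$ and a unitary $W:\mathcal E_0\to\mathcal E_0$ such that $T_\Phi f=T_Wf$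 for all $f\in H^2_{\mathcal E_0}$; (iii) there exist a closed subspace $\mathcal E_0\subseteq\mathcal E$ with $\mathcal M_{T_\Phi}\subseteq H^2_{\mathcal E_0}$ and a unitary $W:\mathcal E_0\to\mathcal E_0$ such that, for almost every $t$, $\mathcal E_0$ reduces $\Phi(e^{it})$ and $\Phi(e^{it})|_{\mathcal E_0}=W$. -/

import Mathlib

open MeasureTheory Real

noncomputable section

namespace VectorToeplitz

instance fact_two_pi_pos : Fact (0 < 2 * π) := ⟨Real.two_pi_pos⟩

/-- The unit circle, parametrised by the angle `t ∈ ℝ / 2πℤ` (the point being `e^{it}`). -/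
abbrev Circ : Type := AddCircle (2 * π)

/-- Normalised Lebesgue measure on the circle. -/
abbrev circMeasure : Measure Circ := AddCircle.haarAddCircle

/-- The Hilbert space `L²_E(𝕋)`. -/
abbrev L2 (E : Type*) [NormedAddCommGroup E] : Type _ := Lp E 2 circMeasure

theorem integrable_L2 {E : Type*} [NormedAddCommGroup E] (f : L2 E) : Integrable f circMeasure :=
  (Lp.memLp f).integrable (by norm_num)

variable (E : Type*) [NormedAddCommGroup E] [InnerProductSpace ℂ E]

/-- The `n`-th Fourier coefficient, as a continuous linear map on `L²_E(𝕋)`. -/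
def coeffL (n : ℤ) : L2 E →L[ℂ] E :=
  LinearMap.mkContinuous
    { toFun := fun f => fourierCoeff (f : Circ → E) n
      map_add' := fun f g => by
        rw [fourierCoeff_congr_ae (Lp.coeFn_add f g)]
        exact congrFun (fourierCoeff.add (integrable_L2 f) (integrable_L2 g)) n
      map_smul' := fun c f => by
        rw [fourierCoeff_congr_ae (Lp.coeFn_smul c f)]
        exact fourierCoeff.const_smul _ c n }
    1 (by
      intro f
      rw [one_mul]
      change ‖fourierCoeff (f : Circ → E) n‖ ≤ ‖f‖
      have h1 : ‖fourierCoeff (f : Circ → E) n‖ ≤ ∫ t, ‖f t‖ ∂circMeasure := by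
        refine (norm_integral_le_integral_norm _).trans_eq ?_
        refine integral_congr_ae (Filter.Eventually.of_forall fun t => ?_)
        simp [norm_smul, Circle.norm_coe]
      refine h1.trans ?_
      rw [integral_norm_eq_lintegral_enorm (Lp.aestronglyMeasurable f), Lp.norm_def,
        ← eLpNorm_one_eq_lintegral_enorm]
      exact ENNReal.toReal_mono (Lp.memLp f).2.ne
        (eLpNorm_le_eLpNorm_of_exponent_le (by norm_num) (Lp.aestronglyMeasurable f)))

/-- The vector-valued Hardy space `H²_E`, realised through boundary values as the closed subspace of
`L²_E(𝕋)` of those functions whose Fourier coefficients of negative index all vanish. -/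
def hardy : ClosedSubmodule ℂ (L2 E) where
  carrier := {f | ∀ n : ℤ, n < 0 → fourierCoeff (f : Circ → E) n = 0}
  add_mem' := fun {f g} hf hg n hn => by
    have := (coeffL E n).map_add f g
    exact this.trans (by
      change fourierCoeff (f : Circ → E) n + fourierCoeff (g : Circ → E) n = 0
      rw [hf n hn, hg n hn, add_zero])
  zero_mem' := fun n _ => (coeffL E n).map_zero
  smul_mem' := fun c f hf n hn => by
    have := (coeffL E n).map_smul c f
    exact this.trans (by
      change c • fourierCoeff (f : Circ → E) n = 0
      rw [hf n hn, smul_zero])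
  isClosed' := by
    have : {f : L2 E | ∀ n : ℤ, n < 0 → fourierCoeff (f : Circ → E) n = 0}
        = ⋂ n : ℤ, ⋂ _ : n < 0, (coeffL E n) ⁻¹' {0} := by
      ext f; simp [coeffL]
    change IsClosed {f : L2 E | ∀ n : ℤ, n < 0 → fourierCoeff (f : Circ → E) n = 0}
    rw [this]
    exact isClosed_iInter fun n => isClosed_iInter fun _ =>
      isClosed_singleton.preimage (coeffL E n).continuous

/-- `H²_E` as a Hilbert space. -/
abbrev H2 : Type _ := (hardy E).toSubmodule

instance [CompleteSpace E] : CompleteSpace (H2 E) :=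
  (hardy E).isClosed'.completeSpace_coe

/-- Symbols in `L^∞_{B(E)}(𝕋)`: essentially bounded operator-valued functions. Measurability means
measurability in the strong operator topology when `E` is separable (equivalently, measurability of
all `t ↦ ⟪Φ(t) x, y⟫`), and strong (Bochner) measurability into `B(E)` with its operator norm when
`E` is an arbitrary Hilbert space. -/
structure Symbol where
  toFun : Circ → E →L[ℂ] E
  measurable' : (TopologicalSpace.SeparableSpace E ∧
      ∀ x : E, AEStronglyMeasurable (fun t => toFun t x) circMeasure) ∨
    AEStronglyMeasurable toFun circMeasure
  bounded' : ∃ C : ℝ, ∀ᵐ t ∂circMeasure, ‖toFun t‖ ≤ C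

variable {E}

instance : CoeFun (Symbol E) (fun _ => Circ → E →L[ℂ] E) := ⟨Symbol.toFun⟩

theorem Symbol.aesm_const (Φ : Symbol E) (x : E) :
    AEStronglyMeasurable (fun t => Φ t x) circMeasure := by
  rcases Φ.measurable' with h | h
  · exact h.2 x
  · exact h.apply_continuousLinearMap x

theorem Symbol.aesm_apply (Φ : Symbol E) {f : Circ → E}
    (hf : AEStronglyMeasurable f circMeasure) :
    AEStronglyMeasurable (fun t => Φ t (f t)) circMeasure := by
  obtain ⟨g, hg, hfg⟩ := hf
  suffices h : AEStronglyMeasurable (fun t => Φ t (g t)) circMeasure by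
    refine h.congr ?_
    filter_upwards [hfg] with t ht
    rw [ht]
  refine aestronglyMeasurable_of_tendsto_ae Filter.atTop
    (f := fun n t => Φ t (hg.approx n t)) (fun n => ?_)
    (Filter.Eventually.of_forall fun t =>
      ((Φ t).continuous.tendsto _).comp (hg.tendsto_approx t))
  have : (fun t => Φ t (hg.approx n t)) = fun t => ∑ y ∈ (hg.approx n).range,
      ((hg.approx n) ⁻¹' {y}).indicator (fun t => Φ t y) t := by
    funext t
    rw [Finset.sum_eq_single (hg.approx n t)]
    · simp
    · intro y _ hy
      exact Set.indicator_of_notMem (by simpa using hy.symm) _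
    · intro h
      exact absurd (SimpleFunc.mem_range_self _ t) h
  rw [this]
  exact Finset.aestronglyMeasurable_fun_sum _ fun y _ =>
    (Φ.aesm_const y).indicator ((hg.approx n).measurableSet_preimage _)

theorem Symbol.memLp_apply (Φ : Symbol E) (f : L2 E) :
    MemLp (fun t => Φ t (f t)) 2 circMeasure := by
  obtain ⟨C, hC⟩ := Φ.bounded'
  refine (Lp.memLp f).of_le_mul (c := C) (Φ.aesm_apply (Lp.aestronglyMeasurable f)) ?_
  filter_upwards [hC] with t ht
  exact (Φ t).le_of_opNorm_le ht _

/-- The Laurent (multiplication) operator `(L_Φ f)(t) = Φ(t) f(t)` on `L²_E(𝕋)`. -/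
def laurent (Φ : Symbol E) : L2 E →L[ℂ] L2 E :=
  LinearMap.mkContinuous
    { toFun := fun f => (Φ.memLp_apply f).toLp (fun t => Φ t (f t))
      map_add' := fun f g => by
        rw [← MemLp.toLp_add (Φ.memLp_apply f) (Φ.memLp_apply g)]
        refine (MemLp.toLp_eq_toLp_iff _ _).2 ?_
        filter_upwards [Lp.coeFn_add f g] with t ht
        rw [ht]
        exact (Φ t).map_add _ _
      map_smul' := fun c f => by
        rw [RingHom.id_apply, ← MemLp.toLp_const_smul c (Φ.memLp_apply f)]
        refine (MemLp.toLp_eq_toLp_iff _ _).2 ?_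
        filter_upwards [Lp.coeFn_smul c f] with t ht
        rw [ht]
        exact (Φ t).map_smul _ _ }
    Φ.bounded'.choose (by
      intro f
      refine Lp.norm_le_mul_norm_of_ae_le_mul ?_
      filter_upwards [Φ.bounded'.choose_spec, (Φ.memLp_apply f).coeFn_toLp] with t ht h
      change ‖(Φ.memLp_apply f).toLp (fun t => Φ t (f t)) t‖ ≤ _
      rw [h]
      exact (Φ t).le_of_opNorm_le ht _)

theorem laurent_coeFn (Φ : Symbol E) (f : L2 E) :
    laurent Φ f =ᵐ[circMeasure] fun t => Φ t (f t) :=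
  (Φ.memLp_apply f).coeFn_toLp

/-- The constant symbol with value `A`. -/
def constSymbol (A : E →L[ℂ] E) : Symbol E where
  toFun := fun _ => A
  measurable' := Or.inr aestronglyMeasurable_const
  bounded' := ⟨‖A‖, Filter.Eventually.of_forall fun _ => le_rfl⟩

section Hilbert

variable [CompleteSpace E]

/-- The Toeplitz operator `T_Φ = P_{H²_E} L_Φ |_{H²_E}` on the Hardy space. -/
def toeplitz (Φ : Symbol E) : H2 E →L[ℂ] H2 E :=
  (hardy E).toSubmodule.orthogonalProjectionOnto ∘L laurent Φ ∘L (hardy E).toSubmodule.subtypeL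

/-- For a closed subspace `E₀` of `E`, the Hardy space `H²_{E₀}` viewed inside `H²_E`: the functions
in `H²_E` with values in `E₀` almost everywhere. -/
def hardySub (E₀ : ClosedSubmodule ℂ E) : Submodule ℂ (H2 E) where
  carrier := {f | ∀ᵐ t ∂circMeasure, (f : L2 E) t ∈ E₀}
  add_mem' := fun {f g} hf hg => by
    change ∀ᵐ t ∂circMeasure, ((f : L2 E) + (g : L2 E)) t ∈ E₀
    filter_upwards [hf, hg, Lp.coeFn_add (f : L2 E) (g : L2 E)] with t h1 h2 h3
    rw [h3]
    exact add_mem h1 h2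
  zero_mem' := by
    change ∀ᵐ t ∂circMeasure, (0 : L2 E) t ∈ E₀
    filter_upwards [Lp.coeFn_zero E 2 circMeasure] with t h
    rw [h]
    exact zero_mem E₀
  smul_mem' := fun c f hf => by
    change ∀ᵐ t ∂circMeasure, (c • (f : L2 E)) t ∈ E₀
    filter_upwards [hf, Lp.coeFn_smul c (f : L2 E)] with t h1 h2
    rw [h2]
    exact E₀.toSubmodule.smul_mem c h1

/-- A unitary operator `W` of a closed subspace `E₀`, regarded as an operator on `E` (it vanishes on
the orthogonal complement of `E₀`). -/
def extendByZero (E₀ : ClosedSubmodule ℂ E) (W : E₀.toSubmodule ≃ₗᵢ[ℂ] E₀.toSubmodule) : E →L[ℂ] E :=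
  E₀.toSubmodule.subtypeL ∘L (W.toContinuousLinearEquiv : E₀.toSubmodule →L[ℂ] E₀.toSubmodule) ∘L
    E₀.toSubmodule.orthogonalProjectionOnto

end Hilbert

section UnitaryPart

variable {H : Type*} [NormedAddCommGroup H] [InnerProductSpace ℂ H] [CompleteSpace H]

/-- The closed subspace `N` reduces the operator `T`: it is invariant under `T` and under `T*`. -/
def Reduces (T : H →L[ℂ] H) (N : ClosedSubmodule ℂ H) : Prop :=
  (∀ x ∈ N, T x ∈ N) ∧ ∀ x ∈ N, ContinuousLinearMap.adjoint T x ∈ N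

/-- `N` reduces `T` and `T|_N : N → N` is unitary, i.e. isometric and onto. -/
def IsUnitarySubspace (T : H →L[ℂ] H) (N : ClosedSubmodule ℂ H) : Prop :=
  Reduces T N ∧ (∀ x ∈ N, ‖T x‖ = ‖x‖) ∧ ∀ y ∈ N, ∃ x ∈ N, T x = y

/-- The unitary part of `T`: the closed linear span of all closed reducing subspaces on which `T` is
unitary. It is itself such a subspace, hence the largest one (see `unitaryPart_isGreatest`). -/
def unitaryPart (T : H →L[ℂ] H) : ClosedSubmodule ℂ H :=
  sSup {N | IsUnitarySubspace T N}

theorem IsUnitarySubspace.adjoint_apply_apply {T : H →L[ℂ] H} {N : ClosedSubmodule ℂ H}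
    (h : IsUnitarySubspace T N) {x : H} (hx : x ∈ N) : ContinuousLinearMap.adjoint T (T x) = x := by
  let V : N.toSubmodule →ₗᵢ[ℂ] H := ⟨T.toLinearMap.domRestrict N.toSubmodule, fun y => h.2.1 y y.2⟩
  have key : ∀ y ∈ N, inner ℂ (ContinuousLinearMap.adjoint T (T x) - x) y = 0 := fun y hy => by
    have := V.inner_map_map ⟨x, hx⟩ ⟨y, hy⟩
    rw [inner_sub_left, ContinuousLinearMap.adjoint_inner_left, sub_eq_zero]
    exact this
  exact sub_eq_zero.1 (inner_self_eq_zero.1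
    (key _ (N.toSubmodule.sub_mem (h.1.2 _ (h.1.1 _ hx)) hx)))

theorem unitaryPart_isGreatest (T : H →L[ℂ] H) :
    IsGreatest {N | IsUnitarySubspace T N} (unitaryPart T) := by
  have le : ∀ N, IsUnitarySubspace T N → N ≤ unitaryPart T := fun N hN => le_sSup hN
  have closed : ∀ (A : H →L[ℂ] H) (K : ClosedSubmodule ℂ H),
      (∀ N, IsUnitarySubspace T N → ∀ x ∈ N, A x ∈ K) → ∀ x ∈ unitaryPart T, A x ∈ K := by
    intro A K hK
    have : unitaryPart T ≤ K.comap A := sSup_le fun N hN x hx => hK N hN x hx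
    exact fun x hx => this hx
  have h1 : ∀ x ∈ unitaryPart T, ContinuousLinearMap.adjoint T (T x) = x := fun x hx =>
    sub_eq_zero.1 (closed (ContinuousLinearMap.adjoint T ∘L T - .id ℂ H) ⊥
      (fun N hN x hx => by simp [hN.adjoint_apply_apply hx]) x hx)
  have h2 : ∀ x ∈ unitaryPart T, T (ContinuousLinearMap.adjoint T x) = x := fun x hx =>
    sub_eq_zero.1 (closed (T ∘L ContinuousLinearMap.adjoint T - .id ℂ H) ⊥
      (fun N hN x hx => by
        obtain ⟨y, hy, rfl⟩ := hN.2.2 x hx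
        simp [hN.adjoint_apply_apply hy]) x hx)
  have h3 : ∀ x ∈ unitaryPart T, ContinuousLinearMap.adjoint T x ∈ unitaryPart T :=
    closed _ _ fun N hN x hx => le N hN (hN.1.2 x hx)
  refine ⟨⟨⟨closed T _ fun N hN x hx => le N hN (hN.1.1 x hx), h3⟩, fun x hx => ?_,
    fun y hy => ⟨_, h3 y hy, h2 y hy⟩⟩, fun N hN => le N hN⟩
  have h : inner ℂ (T x) (T x) = inner ℂ x x := by
    rw [← ContinuousLinearMap.adjoint_inner_left, h1 x hx]
  rw [inner_self_eq_norm_sq_to_K, inner_self_eq_norm_sq_to_K] at h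
  exact (sq_eq_sq₀ (norm_nonneg _) (norm_nonneg _)).1 (by exact_mod_cast h)

end UnitaryPart

end VectorToeplitz

end

/-! The main implication is (i) ⇒ (iii). Multiplication by powers of z commutes with `laurent Φ`,
and the spaces z^(-n) H² exhaust a dense subspace of L², so `laurent Φ` is a contraction because
`toeplitz Φ` is (`norm_laurent_apply_le`). Where T_Φ is isometric the projection onto H² therefore
loses nothing, and T_Φ is plain multiplication (`coe_toeplitz_of_norm_eq`).

If the unitary part is H²_{E₀}, then L_Φ maps H²_{E₀} isometrically onto itself and commutes with z,
so it preserves the wandering subspace H²_{E₀} ⊖ z H²_{E₀}, which consists of the constants in E₀.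
This yields W (`exists_unitary_laurent_constL`). With P the projection onto E₀, it says Φ(t)P = WP
a.e.; contractivity of L_Φ also gives PΦ(t) = WP, so P commutes with Φ(t) and E₀ reduces it
(`ae_reduces_of_laurent_constL`).

Conversely, (iii) gives (ii') pointwise. Under (ii'), T_Φ is unitary on H²_{E₀}, so maximality
forces the unitary part to be all of H²_{E₀} (`unitaryPart_eq_hardySub`), which gives (ii).
Comparing domains in (ii) gives (i). -/

namespace VectorToeplitz

/-! ### Powers of z, constants and Fourier coefficients in L²_E. -/

variable {E : Type*} [NormedAddCommGroup E] [InnerProductSpace ℂ E]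

/-- The scalar symbol `z ^ n`. -/
noncomputable def monomialSymbol (E : Type*) [NormedAddCommGroup E] [InnerProductSpace ℂ E] (n : ℤ) :
    Symbol E where
  toFun := fun t => fourier n t • ContinuousLinearMap.id ℂ E
  measurable' := Or.inr
    (((fourier n).continuous.smul continuous_const).aestronglyMeasurable)
  bounded' := ⟨‖ContinuousLinearMap.id ℂ E‖, Filter.Eventually.of_forall fun t => by
    simp [norm_smul, Circle.norm_coe]⟩

/-- Multiplication by `z ^ n` on `L²_E(𝕋)`. -/
noncomputable def shift (n : ℤ) : L2 E →L[ℂ] L2 E := laurent (monomialSymbol E n)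

theorem shift_coeFn (n : ℤ) (f : L2 E) : shift n f =ᵐ[circMeasure] fun t => fourier n t • f t :=
  laurent_coeFn _ f

theorem shift_shift (m n : ℤ) (f : L2 E) : shift m (shift n f) = shift (m + n) f := by
  refine Lp.ext ?_
  filter_upwards [shift_coeFn m (shift n f), shift_coeFn n f, shift_coeFn (m + n) f]
    with t h1 h2 h3
  rw [h1, h2, h3, smul_smul, fourier_add]

theorem shift_zero (f : L2 E) : shift 0 f = f := by
  refine Lp.ext ?_
  filter_upwards [shift_coeFn 0 f] with t h
  rw [h, fourier_zero, one_smul]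

theorem inner_shift_shift (n : ℤ) (f g : L2 E) : inner ℂ (shift n f) (shift n g) = inner ℂ f g := by
  rw [L2.inner_def, L2.inner_def]
  refine integral_congr_ae ?_
  filter_upwards [shift_coeFn n f, shift_coeFn n g] with t h1 h2
  have : (starRingEnd ℂ) (fourier n t) * fourier n t = 1 := by
    rw [← fourier_neg, ← fourier_add]; simp
  rw [h1, h2, inner_smul_left, inner_smul_right, ← mul_assoc, this, one_mul]

theorem inner_shift_left (n : ℤ) (f g : L2 E) :
    inner ℂ (shift n f) g = inner ℂ f (shift (-n) g) := by
  rw [← inner_shift_shift n f, shift_shift, add_neg_cancel, shift_zero]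

theorem norm_shift (n : ℤ) (f : L2 E) : ‖shift n f‖ = ‖f‖ := by
  have h := inner_shift_shift n f f
  rw [inner_self_eq_norm_sq_to_K, inner_self_eq_norm_sq_to_K] at h
  exact (sq_eq_sq₀ (norm_nonneg _) (norm_nonneg _)).1 (by exact_mod_cast h)

theorem laurent_shift (Φ : Symbol E) (n : ℤ) (f : L2 E) :
    laurent Φ (shift n f) = shift n (laurent Φ f) := by
  refine Lp.ext ?_
  filter_upwards [laurent_coeFn Φ (shift n f), shift_coeFn n f, shift_coeFn n (laurent Φ f),
    laurent_coeFn Φ f] with t h1 h2 h3 h4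
  rw [h1, h2, h3, h4, map_smul]

theorem coeffL_apply (n : ℤ) (f : L2 E) : coeffL E n f = fourierCoeff (f : Circ → E) n := rfl

theorem coeffL_shift (m n : ℤ) (f : L2 E) : coeffL E m (shift n f) = coeffL E (m - n) f := by
  rw [coeffL_apply, coeffL_apply, fourierCoeff_congr_ae (shift_coeFn n f)]
  refine integral_congr_ae (Filter.Eventually.of_forall fun t => ?_)
  change fourier (-m) t • (fourier n t • f t) = fourier (-(m - n)) t • f t
  rw [smul_smul, ← fourier_add]
  rw [show -m + n = -(m - n) by ring]

theorem mem_hardy_iff {f : L2 E} : f ∈ hardy E ↔ ∀ n : ℤ, n < 0 → coeffL E n f = 0 := Iff.rfl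

theorem shift_mem_hardy {f : L2 E} (hf : f ∈ hardy E) {n : ℤ} (hn : 0 ≤ n) :
    shift n f ∈ hardy E := mem_hardy_iff.2 fun m hm => by
  rw [coeffL_shift]
  exact mem_hardy_iff.1 hf _ (by omega)

variable (E) in
/-- The constant functions in `L²_E(𝕋)`. -/
noncomputable def constL : E →L[ℂ] L2 E := Lp.constL 2 circMeasure ℂ

theorem constL_coeFn (x : E) : constL E x =ᵐ[circMeasure] fun _ => x := Lp.coeFn_const ..

section Complete

variable [CompleteSpace E]

theorem inner_constL_left (x : E) (f : L2 E) :
    inner ℂ (constL E x) f = inner ℂ x (coeffL E 0 f) := by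
  have h0 : coeffL E 0 f = ∫ t, f t ∂circMeasure := by
    simp [coeffL_apply, fourierCoeff]
  rw [L2.inner_def, h0, ← integral_inner (integrable_L2 f)]
  refine integral_congr_ae ?_
  filter_upwards [constL_coeFn x] with t h
  rw [h]

/-- Translates orthogonality to z^n x into a condition on the n-th Fourier coefficient. -/
theorem inner_shift_constL_left (n : ℤ) (x : E) (f : L2 E) :
    inner ℂ (shift n (constL E x)) f = inner ℂ x (coeffL E n f) := by
  rw [inner_shift_left, inner_constL_left, coeffL_shift, sub_neg_eq_add, zero_add]

theorem coeffL_zero_constL (x : E) : coeffL E 0 (constL E x) = x := by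
  have h0 : coeffL E 0 (constL E x) = ∫ t, constL E x t ∂circMeasure := by
    simp [coeffL_apply, fourierCoeff]
  rw [h0, integral_congr_ae (constL_coeFn x)]
  simp

theorem norm_constL (x : E) : ‖constL E x‖ = ‖x‖ := by
  have h := inner_constL_left x (constL E x)
  rw [coeffL_zero_constL, inner_self_eq_norm_sq_to_K, inner_self_eq_norm_sq_to_K] at h
  exact (sq_eq_sq₀ (norm_nonneg _) (norm_nonneg _)).1 (by exact_mod_cast h)

/-- A function in `L²_E(𝕋)` all of whose Fourier coefficients vanish is zero. -/
theorem eq_zero_of_coeffL_eq_zero {f : L2 E} (hf : ∀ n, coeffL E n f = 0) : f = 0 := by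
  have key : ∀ x : E, (fun t => inner ℂ x (f t)) =ᵐ[circMeasure] 0 := by
    intro x
    have hm : MemLp (fun t => inner ℂ x (f t)) 2 circMeasure := (Lp.memLp f).const_inner x
    have h0 : hm.toLp _ = 0 := by
      refine fourierBasis.repr.map_eq_zero_iff.1 ?_
      ext n
      rw [fourierBasis_repr, fourierCoeff_congr_ae hm.coeFn_toLp]
      have h1 : fourierCoeff (fun t => inner ℂ x (f t)) n = inner ℂ x (coeffL E n f) := by
        rw [coeffL_apply, fourierCoeff, fourierCoeff,
          ← integral_inner ((integrable_L2 f).fourier_smul _)]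
        simp only [inner_smul_right, smul_eq_mul]
      rw [h1, hf, inner_zero_right]
      rfl
    have h1 := hm.coeFn_toLp
    rw [h0] at h1
    exact h1.symm.trans (Lp.coeFn_zero ..)
  refine Lp.ext (Filter.EventuallyEq.trans ?_ (Lp.coeFn_zero ..).symm)
  -- The null set in `key` depends on x and E may be nonseparable, so f is tested through its
  -- integrals over sets, each a vector orthogonal to every x.
  refine (integrable_L2 f).ae_eq_zero_of_forall_setIntegral_eq_zero fun s _ _ => ?_
  refine integral_eq_zero_of_forall_integral_inner_eq_zero ℂ _ (integrable_L2 f).integrableOn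
    fun x => ?_
  exact integral_eq_zero_of_ae (ae_restrict_of_ae (key x))

theorem coeffL_constL_of_ne_zero {n : ℤ} (hn : n ≠ 0) (x : E) : coeffL E n (constL E x) = 0 := by
  have h : fourierCoeff (fourier (T := 2 * π) 0) n = 0 := by
    rw [fourierCoeff_fourier, Pi.single_apply, if_neg hn]
  rw [coeffL_apply, fourierCoeff_congr_ae (constL_coeFn x), fourierCoeff,
    integral_smul_const]
  simp only [fourierCoeff, fourier_zero, smul_eq_mul, mul_one] at h
  rw [h, zero_smul]

theorem constL_mem_hardy (x : E) : constL E x ∈ hardy E :=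
  mem_hardy_iff.2 fun _ hn => coeffL_constL_of_ne_zero hn.ne x

theorem eq_constL_of_coeffL_eq_zero {f : L2 E} (hf : ∀ n ≠ 0, coeffL E n f = 0) :
    f = constL E (coeffL E 0 f) := by
  refine sub_eq_zero.1 (eq_zero_of_coeffL_eq_zero fun n => ?_)
  rw [map_sub, sub_eq_zero]
  by_cases hn : n = 0
  · rw [hn, coeffL_zero_constL]
  · rw [hf n hn, coeffL_constL_of_ne_zero hn]

/-- The functions `z ^ (-n) h` with `h` in the Hardy space are dense in `L²_E(𝕋)`. -/
theorem dense_shift_mem_hardy : Dense {f : L2 E | ∃ n : ℤ, shift n f ∈ hardy E} := by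
  let S : Submodule ℂ (L2 E) :=
    { carrier := {f | ∃ n : ℤ, shift n f ∈ hardy E}
      add_mem' := by
        rintro f g ⟨m, hm⟩ ⟨n, hn⟩
        refine ⟨max m n, ?_⟩
        rw [map_add]
        have h1 := shift_mem_hardy hm (n := max m n - m) (by omega)
        have h2 := shift_mem_hardy hn (n := max m n - n) (by omega)
        rw [shift_shift, sub_add_cancel] at h1 h2
        exact add_mem h1 h2
      zero_mem' := ⟨0, by rw [map_zero]; exact zero_mem _⟩
      smul_mem' := by
        rintro c f ⟨n, hn⟩
        exact ⟨n, by rw [map_smul]; exact (hardy E).toSubmodule.smul_mem c hn⟩ }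
  change Dense (S : Set (L2 E))
  rw [Submodule.dense_iff_topologicalClosure_eq_top, Submodule.topologicalClosure_eq_top_iff,
    Submodule.eq_bot_iff]
  -- Every z^n x lies in S, so a vector orthogonal to S has no nonzero Fourier coefficient.
  refine fun f hf => eq_zero_of_coeffL_eq_zero fun n => ext_inner_left ℂ fun x => ?_
  rw [← inner_shift_constL_left, inner_zero_right]
  refine (Submodule.mem_orthogonal _ _).1 hf _ ⟨-n, ?_⟩
  rw [shift_shift, neg_add_cancel, shift_zero]
  exact constL_mem_hardy x

/-! ### Toeplitz versus Laurent operators. -/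

theorem coe_toeplitz (Φ : Symbol E) (f : H2 E) :
    (toeplitz Φ f : L2 E) = (hardy E).toSubmodule.starProjection (laurent Φ f) := rfl

theorem inner_toeplitz_right (Φ : Symbol E) (f g : H2 E) :
    inner ℂ g (toeplitz Φ f) = inner ℂ (g : L2 E) (laurent Φ f) :=
  Submodule.inner_orthogonalProjectionOnto_eq_of_mem_left g _

/-- A Laurent operator is a contraction if its Toeplitz compression is one. -/
theorem norm_laurent_apply_le {Φ : Symbol E} (hΦ : ‖toeplitz Φ‖ ≤ 1) (f : L2 E) :
    ‖laurent Φ f‖ ≤ ‖f‖ := by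
  -- Shifting f and g by one common power leaves ⟪g, L_Φ f⟫ unchanged and brings both into H².
  have key : ∀ f g : L2 E, (∃ n, shift n f ∈ hardy E) → (∃ n, shift n g ∈ hardy E) →
      ‖inner ℂ g (laurent Φ f)‖ ≤ ‖g‖ * ‖f‖ := by
    rintro f g ⟨m, hm⟩ ⟨n, hn⟩
    have h1 := shift_mem_hardy hm (n := max m n - m) (by omega)
    have h2 := shift_mem_hardy hn (n := max m n - n) (by omega)
    rw [shift_shift, sub_add_cancel] at h1 h2
    have h3 := inner_toeplitz_right Φ ⟨_, h1⟩ ⟨_, h2⟩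
    rw [laurent_shift, inner_shift_shift] at h3
    rw [← h3]
    refine (norm_inner_le_norm (𝕜 := ℂ) (⟨_, h2⟩ : H2 E) (toeplitz Φ ⟨_, h1⟩)).trans ?_
    refine (mul_le_mul_of_nonneg_left ((toeplitz Φ).le_of_opNorm_le hΦ _)
      (norm_nonneg _)).trans_eq ?_
    rw [one_mul, Submodule.coe_norm, Submodule.coe_norm, norm_shift, norm_shift]
  have dense_le : ∀ f : L2 E, (∃ n, shift n f ∈ hardy E) → ‖laurent Φ f‖ ≤ ‖f‖ := by
    intro f hf
    have hcl : IsClosed {g : L2 E | ‖inner ℂ g (laurent Φ f)‖ ≤ ‖g‖ * ‖f‖} :=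
      isClosed_le (by fun_prop) (by fun_prop)
    -- By density in g, the bound may be used at g = L_Φ f.
    have h : ‖inner ℂ (laurent Φ f) (laurent Φ f)‖ ≤ ‖laurent Φ f‖ * ‖f‖ :=
      hcl.closure_subset_iff.2 (fun g hg => key f g hf hg) (dense_shift_mem_hardy _)
    rw [inner_self_eq_norm_sq_to_K, norm_pow, RCLike.norm_ofReal, abs_norm, sq] at h
    rcases (norm_nonneg (laurent Φ f)).eq_or_lt with h0 | h0
    · rw [← h0]
      exact norm_nonneg f
    · exact le_of_mul_le_mul_left h h0
  have hcl : IsClosed {g : L2 E | ‖laurent Φ g‖ ≤ ‖g‖} :=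
    isClosed_le (by fun_prop) (by fun_prop)
  exact hcl.closure_subset_iff.2 dense_le (dense_shift_mem_hardy f)

end Complete

end VectorToeplitz

namespace VectorToeplitz

/-! ### Norm-preserved vectors of contractions. -/

section Contraction

variable {H : Type*} [NormedAddCommGroup H] [InnerProductSpace ℂ H] [CompleteSpace H]

/-- Expanding ‖A*Ax − x‖² gives ‖A*Ax‖² − 2‖x‖² + ‖x‖², which is at most 0. -/
theorem adjoint_apply_apply_of_norm_eq {A : H →L[ℂ] H} (hA : ‖A‖ ≤ 1) {x : H}
    (hx : ‖A x‖ = ‖x‖) : ContinuousLinearMap.adjoint A (A x) = x := by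
  have h1 : ‖ContinuousLinearMap.adjoint A (A x)‖ ≤ ‖x‖ := by
    refine ((ContinuousLinearMap.adjoint A).le_of_opNorm_le
      ((LinearIsometryEquiv.norm_map _ A).trans_le hA) _).trans_eq ?_
    rw [one_mul, hx]
  have h2 : RCLike.re (inner ℂ (ContinuousLinearMap.adjoint A (A x)) x) = ‖x‖ ^ 2 := by
    rw [ContinuousLinearMap.adjoint_inner_left, inner_self_eq_norm_sq, hx]
  have h3 := norm_sub_sq (𝕜 := ℂ) (ContinuousLinearMap.adjoint A (A x)) x
  rw [h2] at h3
  have h4 := pow_le_pow_left₀ (norm_nonneg _) h1 2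
  refine sub_eq_zero.1 (norm_eq_zero.1 (pow_eq_zero_iff two_ne_zero |>.1 (le_antisymm ?_ ?_)))
  · linarith
  · positivity

/-- An invariant subspace on which a contraction is isometric and onto is reducing. -/
theorem isUnitarySubspace_of_norm_le_one {T : H →L[ℂ] H} (hT : ‖T‖ ≤ 1) {N : ClosedSubmodule ℂ H}
    (hmaps : ∀ x ∈ N, T x ∈ N) (hnorm : ∀ x ∈ N, ‖T x‖ = ‖x‖) (honto : ∀ y ∈ N, ∃ x ∈ N, T x = y) :
    IsUnitarySubspace T N := by
  refine ⟨⟨hmaps, fun y hy => ?_⟩, hnorm, honto⟩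
  obtain ⟨x, hx, rfl⟩ := honto y hy
  rwa [adjoint_apply_apply_of_norm_eq hT (hnorm x hx)]

end Contraction

variable {E : Type*} [NormedAddCommGroup E] [InnerProductSpace ℂ E]

theorem coeffL_laurent_constSymbol [CompleteSpace E] (A : E →L[ℂ] E) (n : ℤ) (f : L2 E) :
    coeffL E n (laurent (constSymbol A) f) = A (coeffL E n f) := by
  rw [coeffL_apply, coeffL_apply, fourierCoeff_congr_ae (laurent_coeFn _ f), fourierCoeff,
    fourierCoeff, ← A.integral_comp_comm ((integrable_L2 f).fourier_smul _)]
  simp only [map_smul]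
  rfl

theorem laurent_constSymbol_comp (A B : E →L[ℂ] E) (f : L2 E) :
    laurent (constSymbol A) (laurent (constSymbol B) f) = laurent (constSymbol (A ∘L B)) f := by
  refine Lp.ext ?_
  filter_upwards [laurent_coeFn (constSymbol A) (laurent (constSymbol B) f),
    laurent_coeFn (constSymbol B) f, laurent_coeFn (constSymbol (A ∘L B)) f] with t h1 h2 h3
  rw [h1, h2, h3]
  rfl

theorem mem_hardySub_iff {E₀ : ClosedSubmodule ℂ E} {f : H2 E} :
    f ∈ hardySub E₀ ↔ ∀ᵐ t ∂circMeasure, (f : L2 E) t ∈ E₀ := Iff.rfl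

variable [CompleteSpace E]

theorem laurent_constSymbol_mem_hardy (A : E →L[ℂ] E) {f : L2 E} (hf : f ∈ hardy E) :
    laurent (constSymbol A) f ∈ hardy E := mem_hardy_iff.2 fun n hn => by
  rw [coeffL_laurent_constSymbol, mem_hardy_iff.1 hf n hn, map_zero]

theorem coe_toeplitz_constSymbol (A : E →L[ℂ] E) (f : H2 E) :
    (toeplitz (constSymbol A) f : L2 E) = laurent (constSymbol A) f :=
  Submodule.starProjection_eq_self_iff.2 (laurent_constSymbol_mem_hardy A f.2)

theorem norm_laurent_le_one {Φ : Symbol E} (hΦ : ‖toeplitz Φ‖ ≤ 1) : ‖laurent Φ‖ ≤ 1 :=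
  ContinuousLinearMap.opNorm_le_bound _ zero_le_one fun f => by
    rw [one_mul]
    exact norm_laurent_apply_le hΦ f

/-- On a vector whose norm it preserves, a contractive Toeplitz operator is multiplication. -/
theorem coe_toeplitz_of_norm_eq {Φ : Symbol E} (hΦ : ‖toeplitz Φ‖ ≤ 1) {f : H2 E}
    (hf : ‖toeplitz Φ f‖ = ‖f‖) : (toeplitz Φ f : L2 E) = laurent Φ f := by
  -- From ‖f‖ = ‖P L_Φ f‖ ≤ ‖L_Φ f‖ ≤ ‖f‖; a vector whose norm survives projection lies in the
  -- subspace.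
  have h : ‖(hardy E).toSubmodule.starProjection (laurent Φ f)‖ = ‖laurent Φ (f : L2 E)‖ := by
    refine le_antisymm ((hardy E).toSubmodule.norm_starProjection_apply_le _) ?_
    rw [← coe_toeplitz, ← Submodule.coe_norm, hf]
    exact norm_laurent_apply_le hΦ f
  exact Submodule.starProjection_eq_self_iff.2 ((Submodule.mem_iff_norm_starProjection _ _).2 h)

/-- Since L_Φ* L_Φ f = f, only f needs its norm preserved; g is arbitrary, and is later a constant
outside E₀. -/
theorem inner_laurent_of_norm_eq {Φ : Symbol E} (hΦ : ‖toeplitz Φ‖ ≤ 1) {f : L2 E}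
    (hf : ‖laurent Φ f‖ = ‖f‖) (g : L2 E) :
    inner ℂ (laurent Φ f) (laurent Φ g) = inner ℂ f g := by
  have h := adjoint_apply_apply_of_norm_eq (A := laurent Φ) (norm_laurent_le_one hΦ) hf
  rw [← ContinuousLinearMap.adjoint_inner_left (laurent Φ) g (laurent Φ f), h]

/-! ### The subspaces H²_{E₀} and constant unitary symbols. -/

section HardySub

variable (E₀ : ClosedSubmodule ℂ E)

/-- Recasts the pointwise condition as a fixed-point equation of a bounded operator, from which
closedness and the location of the Fourier coefficients follow. -/
theorem ae_mem_iff_laurent_eq (f : L2 E) : (∀ᵐ t ∂circMeasure, f t ∈ E₀) ↔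
    laurent (constSymbol E₀.toSubmodule.starProjection) f = f := by
  constructor
  · intro h
    refine Lp.ext ?_
    filter_upwards [h, laurent_coeFn (constSymbol E₀.toSubmodule.starProjection) f] with t h1 h2
    rw [h2]
    exact Submodule.starProjection_eq_self_iff.2 h1
  · intro h
    have h0 := laurent_coeFn (constSymbol E₀.toSubmodule.starProjection) f
    rw [h] at h0
    filter_upwards [h0] with t ht
    exact Submodule.starProjection_eq_self_iff.1 ht.symm

theorem coeffL_mem {f : L2 E} (hf : ∀ᵐ t ∂circMeasure, f t ∈ E₀) (n : ℤ) : coeffL E n f ∈ E₀ := by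
  rw [ae_mem_iff_laurent_eq] at hf
  rw [← hf, coeffL_laurent_constSymbol]
  exact Submodule.starProjection_apply_mem _ _

theorem isClosed_hardySub : IsClosed (hardySub E₀ : Set (H2 E)) := by
  have : (hardySub E₀ : Set (H2 E)) =
      {f : H2 E | laurent (constSymbol E₀.toSubmodule.starProjection) (f : L2 E) = f} :=
    Set.ext fun f => ae_mem_iff_laurent_eq E₀ f
  rw [this]
  exact isClosed_eq (by fun_prop) (by fun_prop)

variable {E₀}

theorem extendByZero_apply (W : E₀.toSubmodule ≃ₗᵢ[ℂ] E₀.toSubmodule) (x : E₀.toSubmodule) :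
    extendByZero E₀ W x = W x := by
  simp [extendByZero]

theorem extendByZero_mem (W : E₀.toSubmodule ≃ₗᵢ[ℂ] E₀.toSubmodule) (x : E) :
    extendByZero E₀ W x ∈ E₀ := Subtype.property _

theorem toeplitz_extendByZero_mem (W : E₀.toSubmodule ≃ₗᵢ[ℂ] E₀.toSubmodule) (f : H2 E) :
    toeplitz (constSymbol (extendByZero E₀ W)) f ∈ hardySub E₀ := by
  rw [mem_hardySub_iff, coe_toeplitz_constSymbol]
  filter_upwards [laurent_coeFn (constSymbol (extendByZero E₀ W)) f] with t ht
  rw [ht]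
  exact extendByZero_mem W _

theorem norm_toeplitz_extendByZero (W : E₀.toSubmodule ≃ₗᵢ[ℂ] E₀.toSubmodule) {f : H2 E}
    (hf : f ∈ hardySub E₀) : ‖toeplitz (constSymbol (extendByZero E₀ W)) f‖ = ‖f‖ := by
  rw [Submodule.coe_norm, Submodule.coe_norm, coe_toeplitz_constSymbol, Lp.norm_def, Lp.norm_def]
  congr 1
  refine eLpNorm_congr_norm_ae ?_
  filter_upwards [laurent_coeFn (constSymbol (extendByZero E₀ W)) f, hf] with t ht h0
  rw [ht]
  change ‖extendByZero E₀ W (⟨_, h0⟩ : E₀.toSubmodule)‖ = ‖(⟨_, h0⟩ : E₀.toSubmodule)‖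
  rw [extendByZero_apply, ← Submodule.coe_norm, W.norm_map]

theorem toeplitz_extendByZero_symm (W : E₀.toSubmodule ≃ₗᵢ[ℂ] E₀.toSubmodule) {f : H2 E}
    (hf : f ∈ hardySub E₀) : toeplitz (constSymbol (extendByZero E₀ W))
      (toeplitz (constSymbol (extendByZero E₀ W.symm)) f) = f := by
  refine Subtype.ext ?_
  rw [coe_toeplitz_constSymbol, coe_toeplitz_constSymbol, laurent_constSymbol_comp]
  refine Lp.ext ?_
  filter_upwards [laurent_coeFn (constSymbol (extendByZero E₀ W ∘L extendByZero E₀ W.symm)) f, hf]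
    with t ht h0
  rw [ht]
  change extendByZero E₀ W (extendByZero E₀ W.symm (⟨_, h0⟩ : E₀.toSubmodule)) =
    (⟨_, h0⟩ : E₀.toSubmodule)
  rw [extendByZero_apply, extendByZero_apply, W.apply_symm_apply]

/-- If `T_Φ` agrees with a constant unitary on a Hardy space containing the unitary part, then that
Hardy space is the unitary part. -/
theorem unitaryPart_eq_hardySub {Φ : Symbol E} (hΦ : ‖toeplitz Φ‖ ≤ 1)
    (hle : (unitaryPart (toeplitz Φ)).toSubmodule ≤ hardySub E₀)
    {W : E₀.toSubmodule ≃ₗᵢ[ℂ] E₀.toSubmodule}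
    (hW : ∀ f ∈ hardySub E₀, toeplitz Φ f = toeplitz (constSymbol (extendByZero E₀ W)) f) :
    (unitaryPart (toeplitz Φ)).toSubmodule = hardySub E₀ := by
  refine le_antisymm hle ?_
  let N : ClosedSubmodule ℂ (H2 E) := ⟨hardySub E₀, isClosed_hardySub E₀⟩
  -- On H²_{E₀} the operator T_Φ is T_W, with preimages supplied by `W.symm`.
  have hN : IsUnitarySubspace (toeplitz Φ) N := by
    refine isUnitarySubspace_of_norm_le_one hΦ (fun f hf => ?_) (fun f hf => ?_) fun f hf =>
      ⟨toeplitz (constSymbol (extendByZero E₀ W.symm)) f, toeplitz_extendByZero_mem W.symm f, ?_⟩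
    · rw [hW f hf]
      exact toeplitz_extendByZero_mem W f
    · rw [hW f hf]
      exact norm_toeplitz_extendByZero W hf
    · rw [hW _ (toeplitz_extendByZero_mem W.symm f)]
      exact toeplitz_extendByZero_symm W hf
  exact fun f hf => (unitaryPart_isGreatest (toeplitz Φ)).2 hN hf

theorem toeplitz_eq_of_ae_eq {Φ : Symbol E} {W : E₀.toSubmodule ≃ₗᵢ[ℂ] E₀.toSubmodule}
    (hW : ∀ᵐ t ∂circMeasure, ∀ η : E₀.toSubmodule, Φ t (η : E) = W η) {f : H2 E}
    (hf : f ∈ hardySub E₀) :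
    toeplitz Φ f = toeplitz (constSymbol (extendByZero E₀ W)) f := by
  have h : laurent Φ f = laurent (constSymbol (extendByZero E₀ W)) f := by
    refine Lp.ext ?_
    filter_upwards [hW, hf, laurent_coeFn Φ f,
      laurent_coeFn (constSymbol (extendByZero E₀ W)) f] with t h1 h2 h3 h4
    rw [h3, h4]
    exact (h1 ⟨_, h2⟩).trans (extendByZero_apply W ⟨_, h2⟩).symm
  exact congrArg (hardy E).toSubmodule.orthogonalProjectionOnto h

end HardySub

/-! ### From constants in E₀ to the values of Φ. -/

/-- Equalities `A Φ(t) B x = C x` holding almost everywhere for each fixed `x` hold outside a null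
set that does not depend on `x`. -/
theorem Symbol.ae_comp_eq (Φ : Symbol E) (A B C : E →L[ℂ] E)
    (h : ∀ x, ∀ᵐ t ∂circMeasure, A (Φ t (B x)) = C x) :
    ∀ᵐ t ∂circMeasure, A ∘L Φ t ∘L B = C := by
  rcases Φ.measurable' with ⟨hsep, -⟩ | hm
  · filter_upwards [ae_all_iff.2 fun n => h (TopologicalSpace.denseSeq E n)] with t ht
    refine ContinuousLinearMap.coeFn_injective ?_
    exact (TopologicalSpace.denseRange_denseSeq E).equalizer (A ∘L Φ t ∘L B).continuous
      C.continuous (funext ht)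
  -- In the Bochner case F is integrable, so its set integrals can be evaluated at each x, where
  -- they vanish.
  · let F : Circ → E →L[ℂ] E := fun t => A ∘L Φ t ∘L B - C
    have hF : AEStronglyMeasurable F circMeasure :=
      (((continuous_const.clm_comp (continuous_id.clm_comp continuous_const)).comp_aestronglyMeasurable
        hm).sub aestronglyMeasurable_const)
    have hint : Integrable F circMeasure := by
      obtain ⟨K, hK⟩ := Φ.bounded'
      refine Integrable.of_bound hF (‖A‖ * (K * ‖B‖) + ‖C‖) ?_
      filter_upwards [hK] with t ht
      refine (norm_sub_le _ _).trans (add_le_add_left ?_ _)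
      refine (A.opNorm_comp_le _).trans (mul_le_mul_of_nonneg_left ?_ (norm_nonneg _))
      exact ((Φ t).opNorm_comp_le _).trans (mul_le_mul_of_nonneg_right ht (norm_nonneg _))
    have h0 : F =ᵐ[circMeasure] 0 := by
      refine hint.ae_eq_zero_of_forall_setIntegral_eq_zero fun s _ _ => ?_
      ext x
      rw [ContinuousLinearMap.integral_apply hint.integrableOn]
      refine integral_eq_zero_of_ae (ae_restrict_of_ae ?_)
      filter_upwards [h x] with t ht
      exact sub_eq_zero.2 ht
    filter_upwards [h0] with t ht
    exact sub_eq_zero.1 ht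

/-- If multiplication by `Φ` maps `H²_{E₀}` isometrically onto itself, it maps the constants of
`E₀` to constants of `E₀`, and acts on them as a unitary operator. -/
theorem exists_unitary_laurent_constL {Φ : Symbol E} (hΦ : ‖toeplitz Φ‖ ≤ 1)
    {E₀ : ClosedSubmodule ℂ E} (hM : IsUnitarySubspace (toeplitz Φ)
      ⟨hardySub E₀, isClosed_hardySub E₀⟩) :
    ∃ W : E₀.toSubmodule ≃ₗᵢ[ℂ] E₀.toSubmodule, ∀ η : E₀.toSubmodule,
      laurent Φ (constL E η) = constL E (W η : E) := by
  obtain ⟨⟨hmaps, -⟩, hnorm, honto⟩ := hM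
  have hT : ∀ f (hf : f ∈ hardy E), (∀ᵐ t ∂circMeasure, f t ∈ E₀) →
      laurent Φ f ∈ hardy E ∧ (∀ᵐ t ∂circMeasure, laurent Φ f t ∈ E₀) ∧
        ‖laurent Φ f‖ = ‖f‖ := fun f hf hv => by
    have h1 := hnorm ⟨f, hf⟩ hv
    have h2 := hmaps ⟨f, hf⟩ hv
    have h3 := coe_toeplitz_of_norm_eq hΦ h1
    have h4 := mem_hardySub_iff.1 h2
    rw [Submodule.coe_norm, h3] at h1
    rw [h3] at h4
    refine ⟨?_, h4, h1⟩
    rw [← h3]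
    exact Subtype.property _
  have hsurj : ∀ g (hg : g ∈ hardy E), (∀ᵐ t ∂circMeasure, g t ∈ E₀) →
      ∃ f ∈ hardy E, (∀ᵐ t ∂circMeasure, f t ∈ E₀) ∧ laurent Φ f = g := fun g hg hv => by
    obtain ⟨f, hf, hfg⟩ := honto ⟨g, hg⟩ hv
    refine ⟨f, f.2, hf, ?_⟩
    rw [← coe_toeplitz_of_norm_eq hΦ (hnorm f hf), hfg]
  have hconst : ∀ x ∈ E₀, ∀ᵐ t ∂circMeasure, constL E x t ∈ E₀ := fun x hx => by
    filter_upwards [constL_coeFn x] with t ht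
    rwa [ht]
  have hshift : ∀ (n : ℤ) (f : L2 E), (∀ᵐ t ∂circMeasure, f t ∈ E₀) →
      ∀ᵐ t ∂circMeasure, shift n f t ∈ E₀ := fun n f hf => by
    filter_upwards [hf, shift_coeFn n f] with t h1 h2
    rw [h2]
    exact E₀.toSubmodule.smul_mem _ h1
  -- A function in H²_{E₀} orthogonal to z^n E₀ for all n > 0 is constant: take ζ to be its n-th
  -- coefficient, itself in E₀.
  have of_inner : ∀ f ∈ hardy E, (∀ᵐ t ∂circMeasure, f t ∈ E₀) →
      (∀ n > 0, ∀ ζ ∈ E₀, inner ℂ (shift n (constL E ζ)) f = 0) →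
      f = constL E (coeffL E 0 f) := fun f hf hv h => by
    refine eq_constL_of_coeffL_eq_zero fun n hn => ?_
    rcases hn.lt_or_gt with hn | hn
    · exact mem_hardy_iff.1 hf n hn
    · have h1 := h n hn _ (coeffL_mem E₀ hv n)
      rwa [inner_shift_constL_left, inner_self_eq_zero] at h1
  let W₀ : E →L[ℂ] E := coeffL E 0 ∘L laurent Φ ∘L constL E
  have hW : ∀ η ∈ E₀, laurent Φ (constL E η) = constL E (W₀ η) := fun η hη => by
    obtain ⟨h1, h2, -⟩ := hT _ (constL_mem_hardy η) (hconst η hη)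
    refine of_inner _ h1 h2 fun n hn ζ hζ => ?_
    -- Writing ζ = L_Φ h turns ⟪z^n ζ, L_Φ η⟫ into ⟪z^n h, η⟫, which is 0 because n > 0.
    obtain ⟨h, hh, hv, hL⟩ := hsurj _ (constL_mem_hardy ζ) (hconst ζ hζ)
    rw [← hL, ← laurent_shift, inner_laurent_of_norm_eq hΦ
      (hT _ (shift_mem_hardy hh hn.le) (hshift n h hv)).2.2, ← inner_conj_symm, inner_constL_left,
      coeffL_shift, mem_hardy_iff.1 hh _ (by omega), inner_zero_right, map_zero]
  have hmem : ∀ η ∈ E₀, W₀ η ∈ E₀ := fun η hη =>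
    coeffL_mem E₀ (hT _ (constL_mem_hardy η) (hconst η hη)).2.1 0
  let V : E₀.toSubmodule →ₗᵢ[ℂ] E₀.toSubmodule :=
    ⟨W₀.toLinearMap.restrict hmem, fun η => by
      change ‖W₀ η‖ = ‖(η : E)‖
      rw [← norm_constL (W₀ η), ← hW _ η.2, ← norm_constL (η : E)]
      exact (hT _ (constL_mem_hardy _) (hconst _ η.2)).2.2⟩
  have hV : Function.Surjective V := fun ζ => by
    obtain ⟨h, hh, hv, hL⟩ := hsurj _ (constL_mem_hardy (ζ : E)) (hconst ζ ζ.2)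
    -- The preimage h of ζ is constant: ⟪z^n η, h⟫ = ⟪z^n Wη, ζ⟫ = 0 for n > 0.
    have hc : h = constL E (coeffL E 0 h) := of_inner h hh hv fun n hn η hη => by
      rw [← inner_laurent_of_norm_eq hΦ
        (hT _ (shift_mem_hardy (constL_mem_hardy η) hn.le) (hshift n _ (hconst η hη))).2.2, hL,
        laurent_shift, hW η hη, inner_shift_constL_left, coeffL_constL_of_ne_zero hn.ne',
        inner_zero_right]
    refine ⟨⟨coeffL E 0 h, coeffL_mem E₀ hv 0⟩, Subtype.ext ?_⟩
    change coeffL E 0 (laurent Φ (constL E (coeffL E 0 h))) = ζ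
    rw [← hc, hL, coeffL_zero_constL]
  exact ⟨LinearIsometryEquiv.ofSurjective V hV, fun η => hW η η.2⟩

/-- The hypothesis gives only invariance, Φ(t)P = WP. Reduction needs PΦ(t) = WP as well, and this
comes from preservation of inner products with z^n η. -/
theorem ae_reduces_of_laurent_constL {Φ : Symbol E} (hΦ : ‖toeplitz Φ‖ ≤ 1)
    {E₀ : ClosedSubmodule ℂ E} {W : E₀.toSubmodule ≃ₗᵢ[ℂ] E₀.toSubmodule}
    (hW : ∀ η : E₀.toSubmodule, laurent Φ (constL E η) = constL E (W η : E)) :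
    ∀ᵐ t ∂circMeasure, Reduces (Φ t) E₀ ∧ ∀ η : E₀.toSubmodule, Φ t (η : E) = W η := by
  let P := E₀.toSubmodule.starProjection
  have hP : ∀ x, P x ∈ E₀ := fun x => Submodule.starProjection_apply_mem _ x
  have hPinner : ∀ (η : E₀.toSubmodule) x, inner ℂ (η : E) (P x) = inner ℂ (η : E) x :=
    fun η x => Submodule.inner_orthogonalProjectionOnto_eq_of_mem_left η x
  have right : ∀ᵐ t ∂circMeasure, ContinuousLinearMap.id ℂ E ∘L Φ t ∘L P = extendByZero E₀ W := by
    refine Φ.ae_comp_eq _ _ _ fun x => ?_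
    have h := laurent_coeFn Φ (constL E (P x))
    rw [hW ⟨P x, hP x⟩] at h
    filter_upwards [h, constL_coeFn (P x), constL_coeFn (W ⟨P x, hP x⟩ : E)] with t h1 h2 h3
    rw [h2, h3] at h1
    exact h1.symm
  have left : ∀ᵐ t ∂circMeasure, P ∘L Φ t ∘L ContinuousLinearMap.id ℂ E = extendByZero E₀ W := by
    refine Φ.ae_comp_eq _ _ _ fun x => ?_
    have h : laurent (constSymbol P) (laurent Φ (constL E x)) = constL E (extendByZero E₀ W x) := by
      refine sub_eq_zero.1 (eq_zero_of_coeffL_eq_zero fun n => ?_)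
      rw [map_sub, coeffL_laurent_constSymbol]
      have hmem : P (coeffL E n (laurent Φ (constL E x))) -
          coeffL E n (constL E (extendByZero E₀ W x)) ∈ E₀ := by
        refine E₀.toSubmodule.sub_mem (hP _) (coeffL_mem E₀ ?_ n)
        filter_upwards [constL_coeFn (extendByZero E₀ W x)] with t ht
        rw [ht]
        exact extendByZero_mem W x
      have hinner : ∀ ζ : E₀.toSubmodule, inner ℂ (ζ : E) (P (coeffL E n (laurent Φ (constL E x))) -
          coeffL E n (constL E (extendByZero E₀ W x))) = 0 := fun ζ => by
        -- With ζ = Wη, the pairing of ζ with the n-th coefficient of Φx is ⟪L_Φ z^n η, L_Φ x⟫ =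
        -- ⟪z^n η, x⟫: zero for n ≠ 0, and ⟪Wη, WPx⟫ for n = 0.
        obtain ⟨η, rfl⟩ := W.surjective ζ
        have hnorm : ‖laurent Φ (shift n (constL E (η : E)))‖ = ‖shift n (constL E (η : E))‖ := by
          rw [laurent_shift, hW, norm_shift, norm_shift, norm_constL, norm_constL,
            ← Submodule.coe_norm, W.norm_map, Submodule.coe_norm]
        rw [inner_sub_right, hPinner, ← inner_shift_constL_left, ← hW, ← laurent_shift,
          inner_laurent_of_norm_eq hΦ hnorm, inner_shift_constL_left, sub_eq_zero]
        by_cases hn : n = 0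
        · subst hn
          rw [coeffL_zero_constL, coeffL_zero_constL, ← hPinner]
          exact (W.inner_map_map η ⟨P x, hP x⟩).symm
        · rw [coeffL_constL_of_ne_zero hn, coeffL_constL_of_ne_zero hn, inner_zero_right,
            inner_zero_right]
      exact inner_self_eq_zero.1 (hinner ⟨_, hmem⟩)
    have h0 := laurent_coeFn (constSymbol P) (laurent Φ (constL E x))
    rw [h] at h0
    filter_upwards [h0, laurent_coeFn Φ (constL E x), constL_coeFn x,
      constL_coeFn (extendByZero E₀ W x)] with t h1 h2 h3 h4
    rw [h4, h2, h3] at h1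
    exact h1.symm
  filter_upwards [left, right] with t hl hr
  have happly : ∀ η : E₀.toSubmodule, Φ t (η : E) = W η := fun η => by
    rw [← extendByZero_apply, ← hr]
    change _ = Φ t (P η)
    rw [Submodule.starProjection_eq_self_iff.2 η.2]
  refine ⟨⟨fun x hx => ?_, fun x hx => ?_⟩, happly⟩
  · rw [happly ⟨x, hx⟩]
    exact Subtype.property _
  -- Taking adjoints, P also commutes with Φ(t)*, so E₀ is invariant under it.
  · have h1 : P ∘L Φ t = Φ t ∘L P := hl.trans hr.symm
    have h2 := DFunLike.congr_fun (congrArg ContinuousLinearMap.adjoint h1) x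
    rw [ContinuousLinearMap.adjoint_comp, ContinuousLinearMap.adjoint_comp,
      (isSelfAdjoint_starProjection E₀.toSubmodule).adjoint_eq] at h2
    have h3 : ContinuousLinearMap.adjoint (Φ t) (P x) = P (ContinuousLinearMap.adjoint (Φ t) x) := h2
    rw [Submodule.starProjection_eq_self_iff.2 hx] at h3
    rw [h3]
    exact hP _

end VectorToeplitz

/-! ### The equivalence. -/

theorem theorem3p9 {E : Type*} [NormedAddCommGroup E] [InnerProductSpace ℂ E] [CompleteSpace E]
    (Φ : VectorToeplitz.Symbol E)
    (hcontr : ‖VectorToeplitz.toeplitz Φ‖ ≤ 1)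
    (hne : VectorToeplitz.unitaryPart (VectorToeplitz.toeplitz Φ) ≠ ⊥) :
    List.TFAE [
      -- (i) the unitary part is a Hardy space `H²_{E₀}`
      ∃ E₀ : ClosedSubmodule ℂ E,
        (VectorToeplitz.unitaryPart (VectorToeplitz.toeplitz Φ)).toSubmodule =
          VectorToeplitz.hardySub E₀,
      -- (ii) equality of the two restricted operators, as maps (domains included)
      ∃ E₀ : ClosedSubmodule ℂ E,
        (VectorToeplitz.unitaryPart (VectorToeplitz.toeplitz Φ)).toSubmodule ≤
          VectorToeplitz.hardySub E₀ ∧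
        ∃ W : E₀.toSubmodule ≃ₗᵢ[ℂ] E₀.toSubmodule,
          (VectorToeplitz.toeplitz Φ).toLinearMap.toPMap
              (VectorToeplitz.unitaryPart (VectorToeplitz.toeplitz Φ)).toSubmodule =
            (VectorToeplitz.toeplitz (VectorToeplitz.constSymbol
                (VectorToeplitz.extendByZero E₀ W))).toLinearMap.toPMap
              (VectorToeplitz.hardySub E₀),
      -- (ii') the same, with the agreement only required as `T_Φ f = T_W f` on `H²_{E₀}`
      ∃ E₀ : ClosedSubmodule ℂ E,
        (VectorToeplitz.unitaryPart (VectorToeplitz.toeplitz Φ)).toSubmodule ≤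
          VectorToeplitz.hardySub E₀ ∧
        ∃ W : E₀.toSubmodule ≃ₗᵢ[ℂ] E₀.toSubmodule, ∀ f ∈ VectorToeplitz.hardySub E₀,
          VectorToeplitz.toeplitz Φ f =
            VectorToeplitz.toeplitz (VectorToeplitz.constSymbol
              (VectorToeplitz.extendByZero E₀ W)) f,
      -- (iii) `E₀` reduces `Φ(e^{it})`, which is the same unitary on `E₀` for almost every `t`
      ∃ E₀ : ClosedSubmodule ℂ E,
        (VectorToeplitz.unitaryPart (VectorToeplitz.toeplitz Φ)).toSubmodule ≤
          VectorToeplitz.hardySub E₀ ∧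
        ∃ W : E₀.toSubmodule ≃ₗᵢ[ℂ] E₀.toSubmodule,
          ∀ᵐ t ∂VectorToeplitz.circMeasure,
            VectorToeplitz.Reduces (Φ t) E₀ ∧
            ∀ η : E₀.toSubmodule, Φ t (η : E) = (W η : E)] := by
  tfae_have 1 → 4 := by
    rintro ⟨E₀, hM⟩
    have hN : VectorToeplitz.unitaryPart (VectorToeplitz.toeplitz Φ) =
        ⟨VectorToeplitz.hardySub E₀, VectorToeplitz.isClosed_hardySub E₀⟩ :=
      ClosedSubmodule.toSubmodule_injective hM
    have hU := (VectorToeplitz.unitaryPart_isGreatest (VectorToeplitz.toeplitz Φ)).1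
    rw [hN] at hU
    obtain ⟨W, hW⟩ := VectorToeplitz.exists_unitary_laurent_constL hcontr hU
    exact ⟨E₀, hM.le, W, VectorToeplitz.ae_reduces_of_laurent_constL hcontr hW⟩
  tfae_have 4 → 3 := fun ⟨E₀, hle, W, hW⟩ => ⟨E₀, hle, W, fun _ hf =>
    VectorToeplitz.toeplitz_eq_of_ae_eq (hW.mono fun _ h => h.2) hf⟩
  tfae_have 3 → 2 := by
    rintro ⟨E₀, hle, W, hW⟩
    have hM := VectorToeplitz.unitaryPart_eq_hardySub hcontr hle hW
    refine ⟨E₀, hle, W, LinearPMap.ext hM fun x hx _ => hW x ?_⟩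
    rw [← hM]
    exact hx
  tfae_have 2 → 1 := fun ⟨E₀, _, _, hW⟩ => ⟨E₀, congrArg LinearPMap.domain hW⟩
  tfae_finish
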